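/- A *quantaloid* is a category $\mathcal Q$ whose hom-sets are complete lattices and whose composition preserves arbitrary joins in each variable; for $u:p\to q$, $w:p\to r$ write $w\swarrow u:q\to r$ for the largest $v$ with $v\circ u\le w$. It is *involutive* if it carries maps $(-)^\circ:\mathcal Q(p,q)\to\mathcal Q(q,p)$ that preserve joins and satisfy $1_q^\circ=1_q$, $(v\circ u)^\circ=u^\circ\circ v^\circ$, $u^{\circ\circ}=u$. Let $\mathcal Q$ be a small involutive quantaloid with object set $\mathcal Q_0$. A *$\mathcal Q$-category* is a set $X$ with a type map $|\cdot|:X\to\mathcal Q_0$ and arrows $\alpha(x,y)\in\mathcal Q(|x|,|y|)$ such that $1_{|x|}\le\alpha(x,x)$ and $\alpha(y,z)\circ\alpha(x,y)\le\alpha(x,z)$. A *$\mathcal Q$-functor* $f:(X,\alpha)\to(Y,\beta)$ is a map with $|fx|=|x|$ and $\alpha(x,x')\le\beta(fx,fx')$. Write $x\le y$ if $|x|=|y|$ and $1_{|x|}\le\alpha(x,y)$; $X$ is *separated* if $x\le y\le x$ implies $x=y$. $\mathcal Q$-functors $f:X\to Y$, $g:Y\to X$ are *adjoint*, $f\dashv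 g$, if $x\le gfx$ and $fgy\le y$ for all $x,y$. $X$ is *symmetric* if $\alpha(x,y)=\alpha(y,x)^\circ$; the *symmetrization* $X_{\mathsf s}$ of $X$ has the same typed set and hom $\alpha(x,y)\wedge\alpha(y,x)^\circ$. A *presheaf* of type $q$ on $X$ is a family $\mu(x)\in\mathcal Q(|x|,q)$ with $\mu(x)\circ\alpha(x',x)\le\mu(x')$; presheaves form a $\mathcal Q$-category $\mathsf PX$ with hom $(\mu,\mu')\mapsto\bigwedge_x\mu'(x)\swarrow\mu(x)$. $X$ is *complete* if the Yoneda embedding $\mathsf y_X:X\to\mathsf PX$, $x\mapsto\alpha(-,x)$, has a left adjoint $\sup_X$. Let $\mathcal Q\text{-}\mathbf{SymCat}$ be the category of symmetric $\mathcal Q$-categories and $\mathcal Q$-functors, $\mathcal Q\text{-}\mathbf{Sup}$ the category of separated complete $\mathcal Q$-categories and left adjoint $\mathcal Q$-functors, and $\mathfrak U_{\mathsf s}:\mathcal Q\text{-}\mathbf{Sup}\to\mathcal Q\text{-}\mathbf{SymCat}$ the functor $X\mapsto X_{\mathsf s}$, $f\mapsto f$. It has the left adjoint $\mathfrak P_{\mathsf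 s}:X\mapsto\mathsf PX$, $f\mapsto f^\to$, where $(f^\to\mu)(y)=\bigvee_x\mu(x)\circ\beta(y,fx)$. **Theorem.** (1) The right adjoint functor $\mathfrak U_{\mathsf s}:\mathcal Q\text{-}\mathbf{Sup}\to\mathcal Q\text{-}\mathbf{SymCat}$ is strictly monadic, that is, the canonical comparison functor from $\mathcal Q\text{-}\mathbf{Sup}$ to the Eilenberg–Moore category of the induced monad is an isomorphism of categories. Hence $\mathcal Q\text{-}\mathbf{Sup}$ is isomorphic to the Eilenberg–Moore category of the monad $\mathbb P_{\mathsf s}$ on $\mathcal Q\text{-}\mathbf{SymCat}$ induced by $\mathfrak P_{\mathsf s}\dashv\mathfrak U_{\mathsf s}$; this monad sends $X$ to $(\mathsf PX)_{\mathsf s}$ and $f$ to $f^\to$, has unit $\mathsf y_X$, and has multiplication $\Phi\mapsto\bigvee_{\mu\in\mathsf PX}\Phi(\mu)\circ\mu$. (2) Let $\mathsf V=(\mathsf V,\&,k,{}^\circ)$ be an involutive quantale (a one-object involutive quantaloid), with $p\,\&\,q\le r\iff p\le r/q\iff q\le p\backslash r$. Let $\mathbf D_*(\mathsf V)$ be the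 involutive quantaloid whose objects are the $q\in\mathsf V$ with $q^\circ=q$, whose arrows $p\to q$ are the $d\in\mathsf V$ with $d\le p\wedge q$ and $(d/p)\,\&\,p=d=q\,\&\,(q\backslash d)$, with composition $e\circ d=(e/q)\,\&\,d$ for $d:p\to q$, $e:q\to r$, identities $1_q=q$, and order and involution inherited from $\mathsf V$. A $\mathsf V$-*set* is a symmetric $\mathbf D_*(\mathsf V)$-category. Then $\mathfrak U_{\mathsf s}:\mathbf D_*(\mathsf V)\text{-}\mathbf{Sup}\to\mathsf V\text{-}\mathbf{Set}$ is strictly monadic, and $\mathbf D_*(\mathsf V)\text{-}\mathbf{Sup}$ is isomorphic to the Eilenberg–Moore category of the $\mathsf V$-powerset monad $\mathbb P_{\mathsf s}$ on $\mathsf V$-sets. Explicitly, the elements of $\mathsf P_{\mathsf s}(X,\alpha)$ are exactly the potential $\mathsf V$-subsets: pairs $(\mu,q)$, $\mu:X\to\mathsf V$, $q^\circ=q\in\mathsf V$, with $\mu(x)\le\alpha(x,x)\wedge q$, $(\mu(x)/\alpha(x,x))\,\&\,\alpha(x,x)=\mu(x)=q\,\&\,(q\backslash\mu(x))$ and $(\mu(y)/\alpha(y,y))\,\&\,\alpha(x,y)=\mu(y)\,\&\,(\alpha(y,y)\backslash\alpha(x,y))\le\mu(x)$;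 a map $f:(X,\alpha)\to(Y,\beta)$ acts by $(\mu,q)\mapsto(\lambda,q)$ with $\lambda(y)=\bigvee_x(\mu(x)/\alpha(x,x))\,\&\,\beta(y,fx)$; the unit is $x\mapsto(\alpha(-,x),\alpha(x,x))$; and the multiplication is $(\Phi,p)\mapsto\big(\bigvee_{(\mu,q)}(\Phi(\mu,q)/q)\,\&\,\mu,\;p\big)$. -/

import Mathlib

open CategoryTheory

universe u

namespace QEnriched

/-- A small quantaloid: a small category whose hom-sets are complete lattices and whose
composition preserves arbitrary joins in each variable. -/
class Quantaloid (Q : Type u) extends Category.{u} Q where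
  homLattice : ∀ p q : Q, CompleteLattice (p ⟶ q)
  sSup_comp : ∀ {p q r : Q} (S : Set (p ⟶ q)) (v : q ⟶ r), sSup S ≫ v = ⨆ u ∈ S, u ≫ v
  comp_sSup : ∀ {p q r : Q} (u : p ⟶ q) (S : Set (q ⟶ r)), u ≫ sSup S = ⨆ v ∈ S, u ≫ v

attribute [reducible, instance] Quantaloid.homLattice

/-- A small involutive quantaloid: `dag` is the action on arrows of an identity-on-objects,
join-preserving, contravariant, involutive functor. -/
class InvolutiveQuantaloid (Q : Type u) extends Quantaloid Q where
  dag : ∀ {p q : Q}, (p ⟶ q) → (q ⟶ p)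
  dag_id : ∀ q : Q, dag (𝟙 q) = 𝟙 q
  dag_comp : ∀ {p q r : Q} (u : p ⟶ q) (v : q ⟶ r), dag (u ≫ v) = dag v ≫ dag u
  dag_dag : ∀ {p q : Q} (u : p ⟶ q), dag (dag u) = u
  dag_sSup : ∀ {p q : Q} (S : Set (p ⟶ q)), dag (sSup S) = ⨆ u ∈ S, dag u

section Basic

variable {Q : Type u} [Quantaloid Q]

theorem iSup_comp {ι : Sort*} {p q r : Q} (f : ι → (p ⟶ q)) (v : q ⟶ r) :
    (⨆ i, f i) ≫ v = ⨆ i, f i ≫ v := by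
  rw [iSup, Quantaloid.sSup_comp, iSup_range]

theorem comp_iSup {ι : Sort*} {p q r : Q} (u : p ⟶ q) (f : ι → (q ⟶ r)) :
    u ≫ (⨆ i, f i) = ⨆ i, u ≫ f i := by
  rw [iSup, Quantaloid.comp_sSup, iSup_range]

theorem comp_mono {p q r : Q} {u u' : p ⟶ q} {v v' : q ⟶ r} (hu : u ≤ u') (hv : v ≤ v') :
    u ≫ v ≤ u' ≫ v' := by
  have h1 : u ≫ v ≤ u' ≫ v := by
    have : u' = sSup {u, u'} := by rw [sSup_pair, sup_eq_right.2 hu]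
    rw [this, Quantaloid.sSup_comp]
    exact le_iSup₂_of_le u (by simp) le_rfl
  have h2 : u' ≫ v ≤ u' ≫ v' := by
    have : v' = sSup {v, v'} := by rw [sSup_pair, sup_eq_right.2 hv]
    rw [this, Quantaloid.comp_sSup]
    exact le_iSup₂_of_le v (by simp) le_rfl
  exact h1.trans h2

/-- The left implication `w ↙ u : q ⟶ r` of `u : p ⟶ q` and `w : p ⟶ r`: the largest `v` with
`v ∘ u ≤ w`. -/
def limp {p q r : Q} (w : p ⟶ r) (u : p ⟶ q) : q ⟶ r := sSup {v | u ≫ v ≤ w}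

theorem le_limp {p q r : Q} {w : p ⟶ r} {u : p ⟶ q} {v : q ⟶ r} :
    v ≤ limp w u ↔ u ≫ v ≤ w := by
  constructor
  · intro h
    refine (comp_mono le_rfl h).trans ?_
    rw [limp, Quantaloid.comp_sSup]
    exact iSup₂_le fun _ hv => hv
  · exact fun h => le_sSup h

end Basic

/-- A `Q`-category: a set with a type map to the objects of `Q` and `Q`-valued homs. -/
structure QCat (Q : Type u) [Quantaloid Q] where
  carrier : Type u
  type : carrier → Q
  hom : ∀ x y : carrier, type x ⟶ type y
  id_le : ∀ x, 𝟙 (type x) ≤ hom x x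
  comp_le : ∀ x y z, hom x y ≫ hom y z ≤ hom x z

/-- A `Q`-functor: a type-preserving map with `α(x,x') ≤ β(fx,fx')`. The arrows `eqToHom _` are
identities of `Q`; they only record `|fx| = |x|`. -/
@[ext]
structure QFunctor {Q : Type u} [Quantaloid Q] (X Y : QCat Q) where
  map : X.carrier → Y.carrier
  type_map : ∀ x, Y.type (map x) = X.type x
  hom_le : ∀ x x', X.hom x x' ≤
    eqToHom (type_map x).symm ≫ Y.hom (map x) (map x') ≫ eqToHom (type_map x')

section QCat

variable {Q : Type u} [Quantaloid Q]

/-- The category `Q`-**Cat** of `Q`-categories and `Q`-functors. -/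
instance : Category (QCat Q) where
  Hom X Y := QFunctor X Y
  id X := ⟨fun x => x, fun _ => rfl, fun x x' => by simp⟩
  comp {X Y Z} f g := ⟨fun x => g.map (f.map x), fun x => (g.type_map _).trans (f.type_map x),
    fun x x' => by
      refine (f.hom_le x x').trans ?_
      refine (comp_mono le_rfl (comp_mono (g.hom_le _ _) le_rfl)).trans ?_
      simp⟩

theorem QCat.hom_ext {X Y : QCat Q} {f g : X ⟶ Y} (h : ∀ x, f.map x = g.map x) : f = g :=
  QFunctor.ext (funext h)

@[simp] theorem QCat.id_map (X : QCat Q) (x : X.carrier) : QFunctor.map (𝟙 X) x = x := rfl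

@[simp] theorem QCat.comp_map {X Y Z : QCat Q} (f : X ⟶ Y) (g : Y ⟶ Z) (x : X.carrier) :
    QFunctor.map (f ≫ g) x = g.map (f.map x) := rfl

/-- The underlying preorder of a `Q`-category: `x ≤ y` iff `|x| = |y|` and `1 ≤ α(x,y)`. -/
def QCat.le (X : QCat Q) (x y : X.carrier) : Prop :=
  ∃ h : X.type x = X.type y, eqToHom h ≤ X.hom x y

/-- Separated `Q`-categories. -/
def QCat.IsSeparated (X : QCat Q) : Prop := ∀ x y, X.le x y → X.le y x → x = y

theorem QCat.le_refl (X : QCat Q) (x : X.carrier) : X.le x x := ⟨rfl, X.id_le x⟩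

theorem QCat.le_trans (X : QCat Q) {x y z : X.carrier} (h : X.le x y) (k : X.le y z) :
    X.le x z := by
  obtain ⟨h, h'⟩ := h
  obtain ⟨k, k'⟩ := k
  refine ⟨h.trans k, ?_⟩
  rw [← eqToHom_trans h k]
  exact (comp_mono h' k').trans (X.comp_le _ _ _)

theorem QFunctor.mono {X Y : QCat Q} (f : X ⟶ Y) {x y : X.carrier} (h : X.le x y) :
    Y.le (f.map x) (f.map y) := by
  obtain ⟨h, h'⟩ := h
  refine ⟨(f.type_map x).trans (h.trans (f.type_map y).symm), ?_⟩
  have := comp_mono (le_refl (eqToHom (f.type_map x)))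
    (comp_mono (h'.trans (f.hom_le x y)) (le_refl (eqToHom (f.type_map y).symm)))
  simpa using this

/-- `f ⊣ g` in `Q`-**Cat**: `1 ≤ gf` and `fg ≤ 1`, pointwise in the underlying orders. -/
def IsAdjoint {X Y : QCat Q} (f : X ⟶ Y) (g : Y ⟶ X) : Prop :=
  (∀ x, X.le x (g.map (f.map x))) ∧ ∀ y, Y.le (f.map (g.map y)) y

/-- `f` is a left adjoint `Q`-functor. -/
def IsLeftAdjoint {X Y : QCat Q} (f : X ⟶ Y) : Prop := ∃ g : Y ⟶ X, IsAdjoint f g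

theorem IsAdjoint.le_iff {X Y : QCat Q} {f : X ⟶ Y} {g : Y ⟶ X} (h : IsAdjoint f g)
    {x : X.carrier} {y : Y.carrier} : Y.le (f.map x) y ↔ X.le x (g.map y) :=
  ⟨fun k => X.le_trans (h.1 x) (g.mono k), fun k => Y.le_trans (f.mono k) (h.2 y)⟩

theorem IsAdjoint.id (X : QCat Q) : IsAdjoint (𝟙 X) (𝟙 X) :=
  ⟨fun x => X.le_refl x, fun x => X.le_refl x⟩

theorem IsAdjoint.comp {X Y Z : QCat Q} {f : X ⟶ Y} {g : Y ⟶ X} {f' : Y ⟶ Z} {g' : Z ⟶ Y}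
    (h : IsAdjoint f g) (h' : IsAdjoint f' g') : IsAdjoint (f ≫ f') (g' ≫ g) :=
  ⟨fun x => X.le_trans (h.1 x) (g.mono (h'.1 _)), fun z => Z.le_trans (f'.mono (h.2 _)) (h'.2 z)⟩

/-! ### Presheaves -/

/-- A presheaf of type `q` on `X`: a `Q`-distributor from `X` to the one-object `Q`-category of
type `q` with hom `1_q`. -/
@[ext]
structure Presheaf (X : QCat Q) (q : Q) where
  val : ∀ x : X.carrier, X.type x ⟶ q
  dist : ∀ x x', X.hom x' x ≫ val x ≤ val x'

/-- The `Q`-category `PX` of presheaves on `X`, with hom `μ' ↙ μ = ⋀ x, μ'(x) ↙ μ(x)`. -/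
abbrev presheafCat (X : QCat Q) : QCat Q where
  carrier := Σ q : Q, Presheaf X q
  type μ := μ.1
  hom μ μ' := ⨅ x, limp (μ'.2.val x) (μ.2.val x)
  id_le μ := le_iInf fun x => le_limp.2 (by simp)
  comp_le μ ν ξ := le_iInf fun x => le_limp.2 (by
    rw [← Category.assoc]
    refine (comp_mono (le_limp.1 (iInf_le _ x)) le_rfl).trans ?_
    exact le_limp.1 (iInf_le _ x))

theorem presheafCat_le_hom {X : QCat Q} {μ ν : (presheafCat X).carrier} {u : μ.1 ⟶ ν.1} :
    u ≤ (presheafCat X).hom μ ν ↔ ∀ x, μ.2.val x ≫ u ≤ ν.2.val x :=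
  le_iInf_iff.trans (forall_congr' fun _ => le_limp)

theorem presheafCat_comp_hom {X : QCat Q} (μ ν : (presheafCat X).carrier) (x : X.carrier) :
    μ.2.val x ≫ (presheafCat X).hom μ ν ≤ ν.2.val x :=
  presheafCat_le_hom.1 le_rfl x

theorem presheafCat_le {X : QCat Q} {μ ν : (presheafCat X).carrier} :
    (presheafCat X).le μ ν ↔ ∃ h : μ.1 = ν.1, ∀ x, μ.2.val x ≫ eqToHom h ≤ ν.2.val x :=
  exists_congr fun _ => presheafCat_le_hom

theorem presheafCat_isSeparated (X : QCat Q) : (presheafCat X).IsSeparated := by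
  rintro ⟨q, μ⟩ ⟨q', ν⟩ h k
  obtain ⟨h, h'⟩ := presheafCat_le.1 h
  obtain ⟨_, k'⟩ := presheafCat_le.1 k
  dsimp only at h
  subst h
  congr 1
  ext x
  exact le_antisymm (by simpa using h' x) (by simpa using k' x)

/-- The Yoneda embedding `y_X : X ⟶ PX`, `x ↦ α(-,x)`. -/
abbrev yoneda (X : QCat Q) : X ⟶ presheafCat X where
  map x := ⟨X.type x, ⟨fun z => X.hom z x, fun _ _ => X.comp_le _ _ _⟩⟩
  type_map _ := rfl
  hom_le x x' := by
    simp only [eqToHom_refl, Category.id_comp, Category.comp_id]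
    exact le_iInf fun z => le_limp.2 (X.comp_le _ _ _)

/-- `X` is complete: the Yoneda embedding has a left adjoint in `Q`-**Cat**. -/
def QCat.IsComplete (X : QCat Q) : Prop := ∃ s : presheafCat X ⟶ X, IsAdjoint s (yoneda X)

/-- The direct image `f^→ : PX ⟶ PY`, `f^→ μ = μ ∘ f^♮`, that is
`(f^→ μ)(y) = ⋁ x, μ(x) ∘ β(y, fx)`. -/
abbrev directImage {X Y : QCat Q} (f : X ⟶ Y) : presheafCat X ⟶ presheafCat Y where
  map μ := ⟨μ.1, ⟨fun y => ⨆ x, Y.hom y (f.map x) ≫ eqToHom (f.type_map x) ≫ μ.2.val x,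
    fun y y' => by
      rw [comp_iSup]
      refine iSup_mono fun x => ?_
      rw [← Category.assoc]
      exact comp_mono (Y.comp_le _ _ _) le_rfl⟩⟩
  type_map _ := rfl
  hom_le μ ν := by
    simp only [eqToHom_refl, Category.id_comp, Category.comp_id]
    refine le_iInf fun y => le_limp.2 ?_
    rw [iSup_comp]
    refine iSup_mono fun x => ?_
    rw [Category.assoc, Category.assoc]
    exact comp_mono le_rfl (comp_mono le_rfl (presheafCat_comp_hom μ ν x))

/-- The inverse image `f^← : PY ⟶ PX`, `f^← λ = λ ∘ f_♮`, that is `(f^← λ)(x) = λ(fx)`. -/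
abbrev inverseImage {X Y : QCat Q} (f : X ⟶ Y) : presheafCat Y ⟶ presheafCat X where
  map μ := ⟨μ.1, ⟨fun x => eqToHom (f.type_map x).symm ≫ μ.2.val (f.map x),
    fun x x' => by
      refine (comp_mono (f.hom_le x' x) le_rfl).trans ?_
      simp only [Category.assoc, eqToHom_trans_assoc, eqToHom_refl, Category.id_comp]
      exact comp_mono le_rfl (μ.2.dist _ _)⟩⟩
  type_map _ := rfl
  hom_le μ ν := by
    simp only [eqToHom_refl, Category.id_comp, Category.comp_id]
    refine le_iInf fun x => le_limp.2 ?_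
    rw [Category.assoc]
    exact comp_mono le_rfl (presheafCat_comp_hom μ ν _)

theorem directImage_isAdjoint {X Y : QCat Q} (f : X ⟶ Y) :
    IsAdjoint (directImage f) (inverseImage f) := by
  constructor
  · intro μ
    refine presheafCat_le.2 ⟨rfl, fun x => ?_⟩
    have h1 : μ.2.val x ≤ eqToHom (f.type_map x).symm ≫
        Y.hom (f.map x) (f.map x) ≫ eqToHom (f.type_map x) ≫ μ.2.val x := by
      have := comp_mono (le_refl (eqToHom (f.type_map x).symm))
        (comp_mono (Y.id_le (f.map x)) (le_refl (eqToHom (f.type_map x) ≫ μ.2.val x)))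
      simpa using this
    have h2 : eqToHom (f.type_map x).symm ≫
        Y.hom (f.map x) (f.map x) ≫ eqToHom (f.type_map x) ≫ μ.2.val x ≤
        ((inverseImage f).map ((directImage f).map μ)).2.val x :=
      comp_mono le_rfl (le_iSup (fun x' => Y.hom (f.map x) (f.map x') ≫
        eqToHom (f.type_map x') ≫ μ.2.val x') x)
    exact (by simp : μ.2.val x ≫ eqToHom _ = μ.2.val x).le.trans (h1.trans h2)
  · intro ν
    refine presheafCat_le.2 ⟨rfl, fun y => ?_⟩
    refine (by simp : _ ≫ eqToHom _ = ((directImage f).map ((inverseImage f).map ν)).2.val y).le.trans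
      (iSup_le fun x => ?_)
    refine le_trans (le_of_eq ?_) (ν.2.dist (f.map x) y)
    simp [inverseImage]

theorem directImage_id (X : QCat Q) : directImage (𝟙 X) = 𝟙 (presheafCat X) := by
  refine QCat.hom_ext fun μ => presheafCat_isSeparated X _ _ ?_ ?_
  · refine (directImage_isAdjoint _).le_iff.2 (presheafCat_le.2 ⟨rfl, fun x => ?_⟩)
    simp [inverseImage]
  · have := (directImage_isAdjoint (𝟙 X)).1 μ
    refine (presheafCat X).le_trans this (presheafCat_le.2 ⟨rfl, fun x => ?_⟩)
    simp [inverseImage]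

theorem directImage_comp {X Y Z : QCat Q} (f : X ⟶ Y) (g : Y ⟶ Z) :
    directImage (f ≫ g) = directImage f ≫ directImage g := by
  have key : ∀ (μ : (presheafCat X).carrier) (ν : (presheafCat Z).carrier),
      (presheafCat Z).le ((directImage (f ≫ g)).map μ) ν ↔
        (presheafCat Z).le ((directImage f ≫ directImage g).map μ) ν := by
    intro μ ν
    rw [(directImage_isAdjoint _).le_iff,
      ((directImage_isAdjoint f).comp (directImage_isAdjoint g)).le_iff, presheafCat_le,
      presheafCat_le]
    refine exists_congr fun h => forall_congr' fun x => ?_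
    simp [inverseImage]
  exact QCat.hom_ext fun μ => presheafCat_isSeparated Z _ _
    ((key _ _).2 ((presheafCat Z).le_refl _)) ((key _ _).1 ((presheafCat Z).le_refl _))

/-- The supremum in `PX`: `sup Φ = ⋁ μ, Φ(μ) ∘ μ`. -/
abbrev presheafSup (X : QCat Q) : presheafCat (presheafCat X) ⟶ presheafCat X where
  map Φ := ⟨Φ.1, ⟨fun x => ⨆ μ : (presheafCat X).carrier, μ.2.val x ≫ Φ.2.val μ,
    fun x x' => by
      rw [comp_iSup]
      refine iSup_mono fun μ => ?_
      rw [← Category.assoc]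
      exact comp_mono (μ.2.dist _ _) le_rfl⟩⟩
  type_map _ := rfl
  hom_le Φ Ψ := by
    simp only [eqToHom_refl, Category.id_comp, Category.comp_id]
    refine le_iInf fun x => le_limp.2 ?_
    rw [iSup_comp]
    refine iSup_mono fun μ => ?_
    rw [Category.assoc]
    exact comp_mono le_rfl (presheafCat_comp_hom Φ Ψ μ)

theorem presheafSup_isAdjoint (X : QCat Q) :
    IsAdjoint (presheafSup X) (yoneda (presheafCat X)) := by
  constructor
  · intro Φ
    refine presheafCat_le.2 ⟨rfl, fun μ => ?_⟩
    refine (by simp : Φ.2.val μ ≫ eqToHom _ = Φ.2.val μ).le.trans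
      (le_iInf fun x => le_limp.2 ?_)
    exact le_iSup (fun μ : (presheafCat X).carrier => μ.2.val x ≫ Φ.2.val μ) μ
  · intro μ
    refine presheafCat_le.2 ⟨rfl, fun x => ?_⟩
    refine (by simp : _ ≫ eqToHom _ =
      ((presheafSup X).map ((yoneda (presheafCat X)).map μ)).2.val x).le.trans
      (iSup_le fun ν => presheafCat_comp_hom ν μ x)

theorem presheafCat_isComplete (X : QCat Q) : (presheafCat X).IsComplete :=
  ⟨presheafSup X, presheafSup_isAdjoint X⟩

end QCat

/-! ### Separated complete `Q`-categories -/

/-- Separated complete `Q`-categories. -/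
structure QSup (Q : Type u) [Quantaloid Q] where
  toQCat : QCat Q
  separated : toQCat.IsSeparated
  complete : toQCat.IsComplete

/-- Left adjoint `Q`-functors. -/
@[ext]
structure QSup.Hom {Q : Type u} [Quantaloid Q] (X Y : QSup Q) where
  toQFunctor : X.toQCat ⟶ Y.toQCat
  isLeftAdjoint : IsLeftAdjoint toQFunctor

section QSup

variable {Q : Type u} [Quantaloid Q]

/-- The category `Q`-**Sup** of separated complete `Q`-categories and left adjoint
`Q`-functors. -/
instance : Category (QSup Q) where
  Hom X Y := QSup.Hom X Y
  id X := ⟨𝟙 _, 𝟙 _, IsAdjoint.id _⟩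
  comp f g := ⟨f.toQFunctor ≫ g.toQFunctor, by
    obtain ⟨f', hf⟩ := f.isLeftAdjoint
    obtain ⟨g', hg⟩ := g.isLeftAdjoint
    exact ⟨_, hf.comp hg⟩⟩

theorem QSup.hom_ext {X Y : QSup Q} {f g : X ⟶ Y}
    (h : ∀ x, f.toQFunctor.map x = g.toQFunctor.map x) : f = g :=
  QSup.Hom.ext (QCat.hom_ext h)

/-- The left adjoint `sup_X : PX ⟶ X` of the Yoneda embedding (unique since `X` is
separated). -/
noncomputable def QSup.sup (X : QSup Q) : presheafCat X.toQCat ⟶ X.toQCat :=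
  X.complete.choose

theorem QSup.sup_isAdjoint (X : QSup Q) : IsAdjoint X.sup (yoneda X.toQCat) :=
  X.complete.choose_spec

variable (Q)

/-- The forgetful functor `U_c : Q-Sup ⥤ Q-Cat`. -/
abbrev Uc : QSup Q ⥤ QCat Q where
  obj X := X.toQCat
  map f := f.toQFunctor

/-- The presheaf functor `P_c : Q-Cat ⥤ Q-Sup`, `X ↦ PX`, `f ↦ f^→`. -/
abbrev Pc : QCat Q ⥤ QSup Q where
  obj X := ⟨presheafCat X, presheafCat_isSeparated X, presheafCat_isComplete X⟩
  map f := ⟨directImage f, _, directImage_isAdjoint f⟩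
  map_id X := QSup.Hom.ext (directImage_id X)
  map_comp f g := QSup.Hom.ext (directImage_comp f g)

variable {Q}

theorem directImage_yoneda {X Y : QCat Q} (f : X ⟶ Y) (x : X.carrier) :
    (directImage f).map ((yoneda X).map x) = (yoneda Y).map (f.map x) := by
  refine presheafCat_isSeparated Y _ _ ?_ ?_
  · refine (directImage_isAdjoint f).le_iff.2 (presheafCat_le.2 ⟨(f.type_map x).symm, fun z => ?_⟩)
    have := comp_mono (f.hom_le z x) (le_refl (eqToHom (f.type_map x).symm))
    simpa [inverseImage, yoneda] using this
  · refine presheafCat_le.2 ⟨f.type_map x, fun y => ?_⟩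
    refine le_trans ?_ (le_iSup (fun x' => Y.hom y (f.map x') ≫
        eqToHom (f.type_map x') ≫ X.hom x' x) x)
    have := comp_mono (le_refl (Y.hom y (f.map x)))
      (comp_mono (le_refl (eqToHom (f.type_map x))) (X.id_le x))
    simpa [yoneda] using this

theorem sup_directImage {X Y : QSup Q} (f : X ⟶ Y) (μ : (presheafCat X.toQCat).carrier) :
    Y.sup.map ((directImage f.toQFunctor).map μ) = f.toQFunctor.map (X.sup.map μ) := by
  obtain ⟨g, hg⟩ := f.isLeftAdjoint
  have key : ∀ y, Y.toQCat.le (Y.sup.map ((directImage f.toQFunctor).map μ)) y ↔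
      Y.toQCat.le (f.toQFunctor.map (X.sup.map μ)) y := by
    intro y
    rw [Y.sup_isAdjoint.le_iff, (directImage_isAdjoint _).le_iff, hg.le_iff,
      X.sup_isAdjoint.le_iff]
    have h1 : (presheafCat X.toQCat).le
        ((inverseImage f.toQFunctor).map ((yoneda Y.toQCat).map y))
        ((yoneda X.toQCat).map (g.map y)) := by
      refine presheafCat_le.2 ⟨(g.type_map y).symm, fun x => ?_⟩
      obtain ⟨e, he⟩ := hg.1 x
      have k1 := g.hom_le (f.toQFunctor.map x) y
      have k2 := comp_mono he (le_refl (X.toQCat.hom (g.map (f.toQFunctor.map x)) (g.map y)))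
      have k3 := k2.trans (X.toQCat.comp_le _ _ _)
      refine le_trans ?_ k3
      have := comp_mono (le_refl (eqToHom (f.toQFunctor.type_map x).symm))
        (comp_mono k1 (le_refl (eqToHom (g.type_map y).symm)))
      simpa [inverseImage, yoneda] using this
    have h2 : (presheafCat X.toQCat).le ((yoneda X.toQCat).map (g.map y))
        ((inverseImage f.toQFunctor).map ((yoneda Y.toQCat).map y)) := by
      refine (directImage_isAdjoint _).le_iff.1 ?_
      rw [directImage_yoneda]
      exact (yoneda Y.toQCat).mono (hg.2 y)
    exact ⟨fun h => (presheafCat _).le_trans h h1, fun h => (presheafCat _).le_trans h h2⟩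
  exact Y.separated _ _ ((key _).2 (Y.toQCat.le_refl _)) ((key _).1 (Y.toQCat.le_refl _))

variable (Q)

/-- The adjunction `P_c ⊣ U_c` with unit `y` and counit `sup`. -/
noncomputable def pcAdj : Pc Q ⊣ Uc Q where
  unit :=
    { app := fun X => yoneda X
      naturality := fun X Y f => QCat.hom_ext fun x => (directImage_yoneda f x).symm }
  counit :=
    { app := fun X => ⟨X.sup, _, X.sup_isAdjoint⟩
      naturality := fun X Y f => QSup.hom_ext fun μ => sup_directImage f μ }
  left_triangle_components X := QSup.hom_ext fun μ => by
    have h : ∀ ν, (presheafCat X).le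
        (((Pc Q).obj X).sup.map ((directImage (yoneda X)).map μ)) ν ↔ (presheafCat X).le μ ν := by
      intro ν
      rw [((Pc Q).obj X).sup_isAdjoint.le_iff, (directImage_isAdjoint _).le_iff]
      have e : (inverseImage (yoneda X)).map ((yoneda (presheafCat X)).map ν) = ν := by
        obtain ⟨q, ν⟩ := ν
        have : ∀ x, (presheafCat X).hom ((yoneda X).map x) ⟨q, ν⟩ = ν.val x := fun x =>
          le_antisymm
            (by
              have := presheafCat_comp_hom ((yoneda X).map x) ⟨q, ν⟩ x
              refine le_trans ?_ this
              have h := comp_mono (X.id_le x)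
                (le_refl ((presheafCat X).hom ((yoneda X).map x) ⟨q, ν⟩))
              rwa [Category.id_comp] at h)
            (le_iInf fun z => le_limp.2 (ν.dist _ _))
        refine congrArg (Sigma.mk q) (Presheaf.ext (funext fun x => ?_))
        refine Eq.trans ?_ (this x)
        simp
      exact iff_of_eq (congrArg _ e)
    exact presheafCat_isSeparated X _ _ ((h _).2 ((presheafCat X).le_refl _))
      ((h _).1 ((presheafCat X).le_refl _))
  right_triangle_components X := QCat.hom_ext fun x => by
    refine X.separated _ _ (X.sup_isAdjoint.2 x) ?_
    obtain ⟨e, he⟩ := presheafCat_le.1 (X.sup_isAdjoint.1 ((yoneda X.toQCat).map x))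
    refine ⟨e, le_trans ?_ (he x)⟩
    have h := comp_mono (X.toQCat.id_le x) (le_refl (eqToHom e))
    rwa [Category.id_comp] at h

end QSup

/-! ### Symmetric `Q`-categories -/

section SymCat

variable {Q : Type u} [InvolutiveQuantaloid Q]

open InvolutiveQuantaloid (dag)

theorem dag_mono {p q : Q} {u v : p ⟶ q} (h : u ≤ v) : dag u ≤ dag v := by
  have : v = sSup {u, v} := by rw [sSup_pair, sup_eq_right.2 h]
  rw [this, InvolutiveQuantaloid.dag_sSup]
  exact le_iSup₂_of_le u (by simp) le_rfl

theorem dag_le_iff {p q : Q} {u : p ⟶ q} {v : q ⟶ p} : dag u ≤ v ↔ u ≤ dag v :=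
  ⟨fun h => by simpa [InvolutiveQuantaloid.dag_dag] using dag_mono h,
    fun h => by simpa [InvolutiveQuantaloid.dag_dag] using dag_mono h⟩

theorem dag_inf {p q : Q} (u v : p ⟶ q) : dag (u ⊓ v) = dag u ⊓ dag v := by
  refine le_antisymm (le_inf (dag_mono inf_le_left) (dag_mono inf_le_right)) ?_
  rw [← dag_le_iff]
  exact le_inf (dag_le_iff.2 inf_le_left) (dag_le_iff.2 inf_le_right)

theorem dag_eqToHom {p q : Q} (h : p = q) : dag (eqToHom h) = eqToHom h.symm := by
  subst h
  exact InvolutiveQuantaloid.dag_id _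

variable (Q) in
/-- Symmetric `Q`-categories: `α(x,y) = α(y,x)°`. -/
def isSymmetric : ObjectProperty (QCat Q) := fun X => ∀ x y, X.hom x y = dag (X.hom y x)

variable (Q) in
/-- The full subcategory `Q`-**SymCat** of `Q`-**Cat** of symmetric `Q`-categories. -/
abbrev SymCat : Type (u + 1) := (isSymmetric Q).FullSubcategory

/-- The symmetrization `X_s` of `X`, with hom `α_s(x,y) = α(x,y) ∧ α(y,x)°`. -/
abbrev symmetrize (X : QCat Q) : SymCat Q where
  obj :=
    { carrier := X.carrier
      type := X.type
      hom := fun x y => X.hom x y ⊓ dag (X.hom y x)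
      id_le := fun x => le_inf (X.id_le x) (by
        rw [← dag_le_iff, InvolutiveQuantaloid.dag_id]; exact X.id_le x)
      comp_le := fun x y z => le_inf
        ((comp_mono inf_le_left inf_le_left).trans (X.comp_le x y z))
        (by
          refine (comp_mono inf_le_right inf_le_right).trans ?_
          rw [← InvolutiveQuantaloid.dag_comp]
          exact dag_mono (X.comp_le z y x)) }
  property x y := by
    change X.hom x y ⊓ dag (X.hom y x) = dag (X.hom y x ⊓ dag (X.hom x y))
    rw [dag_inf, InvolutiveQuantaloid.dag_dag, inf_comm]

/-- A `Q`-functor from a symmetric `Q`-category to `Y` is one to `Y_s`. -/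
abbrev toSymmetrize {X : QCat Q} (hX : isSymmetric Q X) {Y : QCat Q} (f : X ⟶ Y) :
    X ⟶ (symmetrize Y).obj where
  map := f.map
  type_map := f.type_map
  hom_le x x' := by
    have h : ∀ x x', eqToHom (f.type_map x) ≫ X.hom x x' ≫ eqToHom (f.type_map x').symm ≤
        Y.hom (f.map x) (f.map x') := by
      intro x x'
      have := comp_mono (le_refl (eqToHom (f.type_map x)))
        (comp_mono (f.hom_le x x') (le_refl (eqToHom (f.type_map x').symm)))
      simpa using this
    have h2 : eqToHom (f.type_map x) ≫ X.hom x x' ≫ eqToHom (f.type_map x').symm ≤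
        dag (Y.hom (f.map x') (f.map x)) := by
      rw [← dag_le_iff]
      refine le_trans (le_of_eq ?_) (h x' x)
      rw [InvolutiveQuantaloid.dag_comp, InvolutiveQuantaloid.dag_comp, dag_eqToHom, dag_eqToHom,
        ← hX, Category.assoc]
    have := comp_mono (le_refl (eqToHom (f.type_map x).symm))
      (comp_mono (le_inf (h x x') h2) (le_refl (eqToHom (f.type_map x'))))
    simpa using this

/-- The identity map `X_s ⟶ X`. -/
abbrev fromSymmetrize (X : QCat Q) : (symmetrize X).obj ⟶ X where
  map x := x
  type_map _ := rfl
  hom_le x x' := by simp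

variable (Q)

/-- The symmetrization functor `(-)_s : Q-Cat ⥤ Q-SymCat`; it does not change underlying maps. -/
abbrev symmetrization : QCat Q ⥤ SymCat Q where
  obj X := symmetrize X
  map {X Y} f := ObjectProperty.homMk
    (toSymmetrize (symmetrize X).property (fromSymmetrize X ≫ f))

/-- The inclusion of symmetric `Q`-categories is left adjoint to symmetrization. -/
def symAdj : (isSymmetric Q).ι ⊣ symmetrization Q where
  unit := { app := fun X => ObjectProperty.homMk (toSymmetrize X.property (𝟙 X.obj)) }
  counit := { app := fun X => fromSymmetrize X }

/-- The functor `U_s : Q-Sup ⥤ Q-SymCat`. -/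
abbrev Us : QSup Q ⥤ SymCat Q := Uc Q ⋙ symmetrization Q

/-- The functor `P_s : Q-SymCat ⥤ Q-Sup`. -/
abbrev Ps : SymCat Q ⥤ QSup Q := (isSymmetric Q).ι ⋙ Pc Q

/-- The adjunction `P_s ⊣ U_s`. -/
noncomputable def psAdj : Ps Q ⊣ Us Q := (symAdj Q).comp (pcAdj Q)

/-- The monad on `Q`-**SymCat** induced by `P_s ⊣ U_s`. -/
noncomputable abbrev psMonad : Monad (SymCat Q) := (psAdj Q).toMonad

end SymCat

/-! ### Strict monadicity -/

/-- A right adjoint functor is strictly monadic if the comparison functor to the Eilenberg–Moore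
category of the induced monad is an isomorphism of categories. (Left adjoints being unique up to
isomorphism, it does not matter which adjunction is used; all of them are demanded here.) -/
def IsStrictlyMonadic {C D : Type*} [Category* C] [Category* D] (G : D ⥤ C) : Prop :=
  G.IsRightAdjoint ∧ ∀ (L : C ⥤ D) (adj : L ⊣ G), (Monad.comparison adj).IsIso

/-! ### The quantaloid `D_*(V)` of an involutive quantale `V` -/

open scoped Quantale

/-- An involutive (unital) quantale: the involution `star` preserves arbitrary joins. -/
class IsInvolutiveQuantale (V : Type u) [Monoid V] [CompleteLattice V] [StarMul V] : Prop
    extends IsQuantale V where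
  star_sSup : ∀ S : Set V, star (sSup S) = ⨆ a ∈ S, star a

/-- Objects of `D_*(V)`: hermitian elements of `V`. -/
structure DStar (V : Type u) [Star V] where
  val : V
  herm : star val = val

/-- Arrows `p ⟶ q` of `D_*(V)`: elements `d ≤ p ∧ q` with `(d / p) & p = d = q & (q \ d)`.
Here `p ⇨ₗ d` is `d / p` and `q ⇨ᵣ d` is `q \ d`. -/
@[ext]
structure DStar.Hom {V : Type u} [Monoid V] [CompleteLattice V] [StarMul V]
    (p q : DStar V) where
  val : V
  le_inf : val ≤ p.val ⊓ q.val
  left_div : (p.val ⇨ₗ val) * p.val = val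
  right_div : q.val * (q.val ⇨ᵣ val) = val

namespace DStar

variable {V : Type u} [Monoid V] [CompleteLattice V] [StarMul V]

theorem comp_eq {p q r : DStar V} (d : Hom p q) (e : Hom q r) :
    (q.val ⇨ₗ e.val) * d.val = e.val * (q.val ⇨ᵣ d.val) := by
  conv_lhs => rw [← d.right_div]
  conv_rhs => rw [← e.left_div]
  rw [mul_assoc]

variable [IsInvolutiveQuantale V]

theorem ldiv_mul_le (a b : V) : (a ⇨ₗ b) * a ≤ b :=
  Quantale.leftMulResiduation_le_iff_mul_le.1 le_rfl

theorem mul_rdiv_le (a b : V) : a * (a ⇨ᵣ b) ≤ b :=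
  Quantale.rightMulResiduation_le_iff_mul_le.1 le_rfl

theorem star_mono {a b : V} (h : a ≤ b) : star a ≤ star b := by
  have : b = sSup {a, b} := by rw [sSup_pair, sup_eq_right.2 h]
  rw [this, IsInvolutiveQuantale.star_sSup]
  exact le_iSup₂_of_le a (by simp) le_rfl

instance (p q : DStar V) : PartialOrder (Hom p q) :=
  PartialOrder.lift Hom.val fun _ _ => Hom.ext

instance (p q : DStar V) : SupSet (Hom p q) where
  sSup S :=
    { val := ⨆ d ∈ S, d.val
      le_inf := iSup₂_le fun d _ => d.le_inf
      left_div := le_antisymm (ldiv_mul_le _ _) (iSup₂_le fun d hd => by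
        conv_lhs => rw [← d.left_div]
        refine mul_le_mul_left ?_ _
        exact Quantale.leftMulResiduation_le_iff_mul_le.2
          ((ldiv_mul_le _ _).trans (le_iSup₂_of_le d hd le_rfl)))
      right_div := le_antisymm (mul_rdiv_le _ _) (iSup₂_le fun d hd => by
        conv_lhs => rw [← d.right_div]
        refine mul_le_mul_right ?_ _
        exact Quantale.rightMulResiduation_le_iff_mul_le.2
          ((mul_rdiv_le _ _).trans (le_iSup₂_of_le d hd le_rfl))) }

/-- The order on arrows is inherited from `V`, and joins are those of `V`. -/
instance (p q : DStar V) : CompleteLattice (Hom p q) :=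
  completeLatticeOfSup _ fun S =>
    ⟨fun d hd => le_iSup₂_of_le (f := fun (d : Hom p q) (_ : d ∈ S) => d.val) d hd le_rfl,
      fun _ he => iSup₂_le fun _ hd => he hd⟩

theorem val_sSup {p q : DStar V} (S : Set (Hom p q)) : (sSup S).val = ⨆ d ∈ S, d.val := rfl

theorem val_iSup {p q : DStar V} {ι : Sort*} (f : ι → Hom p q) :
    (⨆ i, f i).val = ⨆ i, (f i).val := by
  rw [iSup, val_sSup, iSup_range]

/-- Identities of `D_*(V)`. -/
def idHom (p : DStar V) : Hom p p where
  val := p.val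
  le_inf := le_inf le_rfl le_rfl
  left_div := le_antisymm (ldiv_mul_le _ _) (by
    conv_lhs => rw [← one_mul p.val]
    exact mul_le_mul_left
      (Quantale.leftMulResiduation_le_iff_mul_le.2 (one_mul p.val).le) _)
  right_div := le_antisymm (mul_rdiv_le _ _) (by
    conv_lhs => rw [← mul_one p.val]
    exact mul_le_mul_right
      (Quantale.rightMulResiduation_le_iff_mul_le.2 (mul_one p.val).le) _)

/-- Composition in `D_*(V)`: `e ∘ d = (e / q) & d = e & (q \ d)`. -/
def compHom {p q r : DStar V} (d : Hom p q) (e : Hom q r) : Hom p r where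
  val := (q.val ⇨ₗ e.val) * d.val
  le_inf := by
    refine le_inf ?_ ?_
    · refine le_trans ?_ (d.le_inf.trans inf_le_left)
      have h : (q.val ⇨ₗ e.val) ≤ (q.val ⇨ₗ q.val) :=
        Quantale.leftMulResiduation_le_iff_mul_le.2
          ((ldiv_mul_le _ _).trans (e.le_inf.trans inf_le_left))
      refine (mul_le_mul_left h _).trans ?_
      conv_lhs => rw [← d.right_div]
      conv_rhs => rw [← d.right_div]
      rw [← mul_assoc]
      exact mul_le_mul_left (ldiv_mul_le _ _) _
    · rw [comp_eq]
      refine le_trans ?_ (e.le_inf.trans inf_le_right)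
      have h : (q.val ⇨ᵣ d.val) ≤ (q.val ⇨ᵣ q.val) :=
        Quantale.rightMulResiduation_le_iff_mul_le.2
          ((mul_rdiv_le _ _).trans (d.le_inf.trans inf_le_right))
      refine (mul_le_mul_right h _).trans ?_
      conv_lhs => rw [← e.left_div]
      conv_rhs => rw [← e.left_div]
      rw [mul_assoc]
      exact mul_le_mul_right (mul_rdiv_le _ _) _
  left_div := le_antisymm (ldiv_mul_le _ _) (by
    conv_lhs => rw [← d.left_div, ← mul_assoc]
    refine mul_le_mul_left (Quantale.leftMulResiduation_le_iff_mul_le.2 ?_) _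
    rw [mul_assoc, d.left_div])
  right_div := le_antisymm (mul_rdiv_le _ _) (by
    rw [comp_eq]
    conv_lhs => rw [← e.right_div, mul_assoc]
    refine mul_le_mul_right (Quantale.rightMulResiduation_le_iff_mul_le.2 ?_) _
    rw [← mul_assoc, e.right_div])

theorem star_ldiv (a b : V) : star (a ⇨ₗ b) = (star a ⇨ᵣ star b) := by
  apply le_antisymm
  · refine Quantale.rightMulResiduation_le_iff_mul_le.2 ?_
    rw [← star_mul]
    exact star_mono (ldiv_mul_le _ _)
  · rw [← star_star (star a ⇨ᵣ star b)]
    refine star_mono (Quantale.leftMulResiduation_le_iff_mul_le.2 ?_)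
    have := star_mono (mul_rdiv_le (star a) (star b))
    rwa [star_mul, star_star, star_star] at this

theorem star_rdiv (a b : V) : star (a ⇨ᵣ b) = (star a ⇨ₗ star b) := by
  have := star_ldiv (star a) (star b)
  rw [star_star, star_star] at this
  rw [← this, star_star]

/-- The involution of `D_*(V)`, lifted from `V`. -/
def dagHom {p q : DStar V} (d : Hom p q) : Hom q p where
  val := star d.val
  le_inf := by
    refine le_inf ?_ ?_
    · conv_rhs => rw [← q.herm]
      exact star_mono (d.le_inf.trans inf_le_right)
    · conv_rhs => rw [← p.herm]
      exact star_mono (d.le_inf.trans inf_le_left)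
  left_div := by
    conv_rhs => rw [← d.right_div]
    rw [star_mul, star_rdiv, q.herm]
  right_div := by
    conv_rhs => rw [← d.left_div]
    rw [star_mul, star_ldiv, p.herm]

theorem compHom_assoc {p q r s : DStar V} (d : Hom p q) (e : Hom q r) (f : Hom r s) :
    compHom (compHom d e) f = compHom d (compHom e f) := Hom.ext (by
  rw [show (compHom d (compHom e f)).val = (compHom e f).val * (q.val ⇨ᵣ d.val) from
    comp_eq d (compHom e f)]
  change (r.val ⇨ₗ f.val) * ((q.val ⇨ₗ e.val) * d.val) =
    (r.val ⇨ₗ f.val) * e.val * (q.val ⇨ᵣ d.val)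
  rw [comp_eq d e, mul_assoc])

theorem sSup_compHom {p q r : DStar V} (S : Set (Hom p q)) (e : Hom q r) :
    compHom (sSup S) e = ⨆ d ∈ S, compHom d e := Hom.ext (by
  simp only [val_iSup]
  change (q.val ⇨ₗ e.val) * (⨆ d ∈ S, d.val) = ⨆ d ∈ S, (q.val ⇨ₗ e.val) * d.val
  rw [← sSup_image, mul_sSup_distrib, iSup_image])

theorem compHom_sSup {p q r : DStar V} (d : Hom p q) (S : Set (Hom q r)) :
    compHom d (sSup S) = ⨆ e ∈ S, compHom d e := Hom.ext (by
  simp only [val_iSup]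
  have h : ∀ e : Hom q r, (compHom d e).val = e.val * (q.val ⇨ᵣ d.val) := comp_eq d
  simp only [h, val_sSup]
  rw [← sSup_image, sSup_mul_distrib, iSup_image])

theorem dagHom_comp {p q r : DStar V} (d : Hom p q) (e : Hom q r) :
    dagHom (compHom d e) = compHom (dagHom e) (dagHom d) := Hom.ext (by
  refine Eq.trans ?_ (comp_eq (dagHom e) (dagHom d)).symm
  change star ((q.val ⇨ₗ e.val) * d.val) = star d.val * (q.val ⇨ᵣ star e.val)
  rw [star_mul, star_ldiv, q.herm])

theorem dagHom_sSup {p q : DStar V} (S : Set (Hom p q)) :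
    dagHom (sSup S) = ⨆ d ∈ S, dagHom d := Hom.ext (by
  simp only [val_iSup]
  change star (⨆ d ∈ S, d.val) = ⨆ d ∈ S, star d.val
  rw [← sSup_image, IsInvolutiveQuantale.star_sSup, iSup_image])

/-- The involutive quantaloid `D_*(V)`. -/
instance : InvolutiveQuantaloid (DStar V) where
  Hom := Hom
  id := idHom
  comp := compHom
  id_comp d := Hom.ext d.left_div
  comp_id {_ q} d := Hom.ext ((comp_eq d (idHom q)).trans d.right_div)
  assoc := compHom_assoc
  homLattice p q := inferInstanceAs (CompleteLattice (Hom p q))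
  sSup_comp := sSup_compHom
  comp_sSup := compHom_sSup
  dag := dagHom
  dag_id p := Hom.ext p.herm
  dag_comp := dagHom_comp
  dag_dag _ := Hom.ext (star_star _)
  dag_sSup := dagHom_sSup

end DStar

/-- The category of `V`-sets: symmetric `D_*(V)`-categories. -/
abbrev QSet (V : Type u) [Monoid V] [CompleteLattice V] [StarMul V] [IsInvolutiveQuantale V] :
    Type (u + 1) :=
  SymCat (DStar V)

/-- The `V`-valued similarity `α(x,y)` of a `V`-set. -/
abbrev QSet.sim {V : Type u} [Monoid V] [CompleteLattice V] [StarMul V] [IsInvolutiveQuantale V]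
    (X : QSet V) (x y : X.obj.carrier) : V :=
  DStar.Hom.val (X.obj.hom x y)

/-- The `V`-powerset monad on `V`-sets. -/
noncomputable abbrev powersetMonad (V : Type u) [Monoid V] [CompleteLattice V] [StarMul V]
    [IsInvolutiveQuantale V] : Monad (QSet V) :=
  psMonad (DStar V)

/-- `(m, q)` is a potential `V`-subset of the `V`-set `X`; here `q` is hermitian. -/
structure IsPotentialSubset {V : Type u} [Monoid V] [CompleteLattice V] [StarMul V]
    [IsInvolutiveQuantale V] (X : QSet V) (m : X.obj.carrier → V) (q : V) : Prop where
  herm : star q = q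
  le_inf : ∀ x, m x ≤ X.sim x x ⊓ q
  left_div : ∀ x, (X.sim x x ⇨ₗ m x) * X.sim x x = m x
  right_div : ∀ x, q * (q ⇨ᵣ m x) = m x
  dist_eq : ∀ x y, (X.sim y y ⇨ₗ m y) * X.sim x y = m y * (X.sim y y ⇨ᵣ X.sim x y)
  dist_le : ∀ x y, (X.sim y y ⇨ₗ m y) * X.sim x y ≤ m x

end QEnriched

open QEnriched
open scoped Quantale

namespace QEnriched

/-! ### Independence of the comparison functor from the left adjoint -/

section Comparison

variable {C D : Type*} [Category* C] [Category* D] {G : D ⥤ C} {L₁ L₂ : C ⥤ D}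

/-- Two left adjoints of the same functor induce isomorphic monads. -/
def toMonadHom (adj₁ : L₁ ⊣ G) (adj₂ : L₂ ⊣ G) : adj₁.toMonad ⟶ adj₂.toMonad where
  app X := G.map ((adj₁.leftAdjointUniq adj₂).hom.app X)
  naturality X Y f := by
    change G.map _ ≫ G.map _ = G.map _ ≫ G.map _
    rw [← G.map_comp, ← G.map_comp, NatTrans.naturality]
  app_η X := adj₁.unit_leftAdjointUniq_hom_app adj₂ X
  app_μ X := by
    have key : adj₁.counit.app (L₁.obj X) ≫ (adj₁.leftAdjointUniq adj₂).hom.app X =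
        (L₁.map (G.map ((adj₁.leftAdjointUniq adj₂).hom.app X)) ≫
          (adj₁.leftAdjointUniq adj₂).hom.app (G.obj (L₂.obj X))) ≫
            adj₂.counit.app (L₂.obj X) := by
      rw [Category.assoc, adj₁.leftAdjointUniq_hom_app_counit adj₂]
      exact (adj₁.counit.naturality _).symm
    have key' := congrArg G.map key
    rw [G.map_comp, G.map_comp, G.map_comp] at key'
    exact key'

theorem comparison_comp_toMonadHom_obj (adj₁ : L₁ ⊣ G) (adj₂ : L₂ ⊣ G) (X : D) :
    (Monad.algebraFunctorOfMonadHom (toMonadHom adj₁ adj₂)).obj ((Monad.comparison adj₂).obj X) =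
      (Monad.comparison adj₁).obj X := by
  have h : G.map ((adj₁.leftAdjointUniq adj₂).hom.app (G.obj X)) ≫ G.map (adj₂.counit.app X) =
      G.map (adj₁.counit.app X) := by
    rw [← G.map_comp, adj₁.leftAdjointUniq_hom_app_counit adj₂]
  simp only [Monad.algebraFunctorOfMonadHom, Monad.comparison]
  congr 1

theorem algebraFunctor_toMonadHom_obj_injective (adj₁ : L₁ ⊣ G) (adj₂ : L₂ ⊣ G) :
    Function.Injective (Monad.algebraFunctorOfMonadHom (toMonadHom adj₁ adj₂)).obj := by
  rintro ⟨A, a, _, _⟩ ⟨B, b, _, _⟩ h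
  obtain ⟨h₁, h₂⟩ := Monad.Algebra.mk.inj h
  dsimp only at h₁
  subst h₁
  have h₃ := eq_of_heq h₂
  have : IsIso ((toMonadHom adj₁ adj₂).app A) :=
    inferInstanceAs (IsIso (G.map ((adj₁.leftAdjointUniq adj₂).hom.app A)))
  have h₄ : a = b := (cancel_epi ((toMonadHom adj₁ adj₂).app A)).1 h₃
  subst h₄
  rfl

theorem comparison_isIso_of_adj (adj₁ : L₁ ⊣ G) (adj₂ : L₂ ⊣ G) [G.Faithful]
    [h : (Monad.comparison adj₁).IsIso] : (Monad.comparison adj₂).IsIso where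
  full := ⟨fun {X Y} f => by
    let f' : (Monad.comparison adj₁).obj X ⟶ (Monad.comparison adj₁).obj Y :=
      { f := f.f
        h := by
          let φ : G.obj X ⟶ G.obj Y := f.f
          have hφ : G.map (L₂.map φ) ≫ G.map (adj₂.counit.app Y) =
            G.map (adj₂.counit.app X) ≫ φ := f.h
          have h₁ : G.map (L₁.map φ) ≫ G.map (adj₁.counit.app Y) =
              G.map ((adj₁.leftAdjointUniq adj₂).hom.app (G.obj X)) ≫
                G.map (L₂.map φ) ≫ G.map (adj₂.counit.app Y) := by
            rw [← adj₁.leftAdjointUniq_hom_app_counit adj₂ Y, G.map_comp, ← G.map_comp_assoc,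
              ← G.map_comp_assoc, NatTrans.naturality]
          refine h₁.trans ?_
          rw [hφ, ← Category.assoc]
          refine congrArg (· ≫ φ) ?_
          exact (G.map_comp _ _).symm.trans
            (congrArg G.map (adj₁.leftAdjointUniq_hom_app_counit adj₂ X)) }
    obtain ⟨g, hg⟩ := (Monad.comparison adj₁).map_surjective f'
    have hg' : G.map g = f.f := congrArg Monad.Algebra.Hom.f hg
    exact ⟨g, Monad.Algebra.Hom.ext hg'⟩⟩
  bijective_obj := by
    constructor
    · intro X Y hXY
      apply h.bijective_obj.1
      rw [← comparison_comp_toMonadHom_obj adj₁ adj₂, hXY, comparison_comp_toMonadHom_obj]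
    · intro B
      obtain ⟨X, hX⟩ := h.bijective_obj.2
        ((Monad.algebraFunctorOfMonadHom (toMonadHom adj₁ adj₂)).obj B)
      refine ⟨X, algebraFunctor_toMonadHom_obj_injective adj₁ adj₂ ?_⟩
      rw [comparison_comp_toMonadHom_obj, hX]

end Comparison

section Adjoints

variable {Q : Type u} [Quantaloid Q]

theorem QCat.IsSeparated.eq_of_le_iff {X : QCat Q} (hX : X.IsSeparated) {x y : X.carrier}
    (h : ∀ z, X.le x z ↔ X.le y z) : x = y :=
  hX _ _ ((h y).2 (X.le_refl y)) ((h x).1 (X.le_refl x))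

theorem IsAdjoint.left_unique {X Y : QCat Q} (hY : Y.IsSeparated) {f f' : X ⟶ Y} {g : Y ⟶ X}
    (h : IsAdjoint f g) (h' : IsAdjoint f' g) : f = f' :=
  QCat.hom_ext fun _ => hY.eq_of_le_iff fun _ => h.le_iff.trans h'.le_iff.symm

theorem presheaf_val_congr {X : QCat Q} {q : Q} (μ : Presheaf X q) {x y : X.carrier} (h : x = y)
    (e : X.type y = X.type x) : eqToHom e ≫ μ.val x = μ.val y := by
  subst h
  simp

/-- If `a` has a section, then direct images along `a` split inverse images along `a`. -/
theorem directImage_inverseImage {X Y : QCat Q} {a : X ⟶ Y} {s : Y ⟶ X} (h : s ≫ a = 𝟙 Y)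
    (ν : (presheafCat Y).carrier) :
    (directImage a).map ((inverseImage a).map ν) = ν := by
  refine presheafCat_isSeparated _ _ _ ((directImage_isAdjoint a).2 ν) ?_
  have e : (directImage a).map ((directImage s).map ν) = ν := by
    change (directImage s ≫ directImage a).map ν = ν
    rw [← directImage_comp, h, directImage_id]
    rfl
  have k : (presheafCat X).le ((directImage s).map ν) ((inverseImage a).map ν) :=
    (directImage_isAdjoint a).le_iff.1 (by rw [e]; exact (presheafCat Y).le_refl _)
  have := (directImage a).mono k
  rwa [e] at this

theorem Pc_obj_sup (X : QCat Q) : ((Pc Q).obj X).sup = presheafSup X :=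
  IsAdjoint.left_unique (presheafCat_isSeparated X) ((Pc Q).obj X).sup_isAdjoint
    (presheafSup_isAdjoint X)

end Adjoints

section Monadicity

variable {Q : Type u} [InvolutiveQuantaloid Q]

theorem SymCat.congr_map {X Y : SymCat Q} {f g : X ⟶ Y} (h : f = g) (x : X.obj.carrier) :
    f.hom.map x = g.hom.map x := by
  rw [h]

/-! ### Suprema of presheaves on symmetrizations -/

/-- `P(X_s) ⟶ X`, the supremum of presheaves on the symmetrization of `X`. -/
noncomputable def QSup.symSup (X : QSup Q) : presheafCat (symmetrize X.toQCat).obj ⟶ X.toQCat :=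
  directImage (fromSymmetrize X.toQCat) ≫ X.sup

/-- `X ⟶ P(X_s)`, `x ↦ X(-,x)`. -/
def symYoneda (X : QCat Q) : X ⟶ presheafCat (symmetrize X).obj :=
  yoneda X ≫ inverseImage (fromSymmetrize X)

theorem QSup.symSup_isAdjoint (X : QSup Q) : IsAdjoint X.symSup (symYoneda X.toQCat) :=
  (directImage_isAdjoint _).comp X.sup_isAdjoint

theorem QSup.symSup_yoneda (X : QSup Q) (x : X.toQCat.carrier) :
    X.symSup.map ((yoneda (symmetrize X.toQCat).obj).map x) = x := by
  have h : X.sup.map ((yoneda X.toQCat).map x) = x :=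
    congrArg (fun f => QFunctor.map f x) ((pcAdj Q).right_triangle_components X)
  change X.sup.map ((directImage (fromSymmetrize X.toQCat)).map _) = x
  rw [directImage_yoneda]
  exact h

theorem QSup.symSup_symYoneda (X : QSup Q) (x : X.toQCat.carrier) :
    X.symSup.map ((symYoneda X.toQCat).map x) = x := by
  refine X.separated _ _ (X.symSup_isAdjoint.2 x) ?_
  have h : (presheafCat _).le ((yoneda (symmetrize X.toQCat).obj).map x)
      ((symYoneda X.toQCat).map x) := by
    refine X.symSup_isAdjoint.le_iff.1 ?_
    rw [X.symSup_yoneda]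
    exact X.toQCat.le_refl x
  have := X.symSup.mono h
  rwa [X.symSup_yoneda] at this

theorem symYoneda_val (X : QCat Q) (x z : X.carrier) :
    ((symYoneda X).map x).2.val z = X.hom z x := by
  simp [symYoneda]

theorem symYoneda_hom (X : QCat Q) (x y : X.carrier) :
    (presheafCat (symmetrize X).obj).hom ((symYoneda X).map x) ((symYoneda X).map y) =
      X.hom x y := by
  refine le_antisymm ?_ (le_iInf fun z => le_limp.2 ?_)
  · have h := presheafCat_comp_hom ((symYoneda X).map x) ((symYoneda X).map y) x
    rw [symYoneda_val, symYoneda_val] at h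
    refine le_trans ?_ h
    have h' := comp_mono (X.id_le x) (le_refl ((presheafCat (symmetrize X).obj).hom
      ((symYoneda X).map x) ((symYoneda X).map y)))
    exact (Category.id_comp _).symm.le.trans h'
  · rw [symYoneda_val, symYoneda_val]
    exact X.comp_le _ _ _

theorem psAdj_counit_app (X : QSup Q) : ((psAdj Q).counit.app X).toQFunctor = X.symSup := by
  simp [psAdj, QSup.symSup]
  rfl

theorem psMonad_η_app_map (X : SymCat Q) (x : X.obj.carrier) :
    ((psMonad Q).η.app X).hom.map x = (yoneda X.obj).map x := rfl

theorem comparison_obj_a_map (X : QSup Q)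
    (μ : (presheafCat (symmetrize X.toQCat).obj).carrier) :
    ((Monad.comparison (psAdj Q)).obj X).a.hom.map μ = X.symSup.map μ := by
  rw [← psAdj_counit_app]
  rfl

/-- `sup : P((PX)_s) ⟶ PX`. -/
def freeSup (X : QCat Q) :
    presheafCat (symmetrize (presheafCat X)).obj ⟶ presheafCat X :=
  directImage (fromSymmetrize _) ≫ presheafSup X

theorem Pc_obj_symSup (X : QCat Q) : ((Pc Q).obj X).symSup = freeSup X := by
  rw [QSup.symSup, Pc_obj_sup]
  rfl

theorem psMonad_μ_app_map (X : SymCat Q)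
    (Φ : (presheafCat (symmetrize (presheafCat X.obj)).obj).carrier) :
    ((psMonad Q).μ.app X).hom.map Φ = (freeSup X.obj).map Φ := by
  rw [← Pc_obj_symSup]
  exact comparison_obj_a_map ((Ps Q).obj X) Φ

theorem freeSup_isAdjoint (X : QCat Q) : IsAdjoint (freeSup X) (symYoneda (presheafCat X)) := by
  rw [← Pc_obj_symSup]
  exact QSup.symSup_isAdjoint _

theorem freeSup_symYoneda (X : QCat Q) (μ : (presheafCat X).carrier) :
    (freeSup X).map ((symYoneda (presheafCat X)).map μ) = μ := by
  rw [← Pc_obj_symSup]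
  exact ((Pc Q).obj X).symSup_symYoneda μ

theorem freeSup_yoneda (X : QCat Q) (μ : (presheafCat X).carrier) :
    (freeSup X).map ((yoneda (symmetrize (presheafCat X)).obj).map μ) = μ := by
  rw [← Pc_obj_symSup]
  exact ((Pc Q).obj X).symSup_yoneda μ

/-! ### Full faithfulness of the comparison functor -/

instance : (Us Q).Faithful where
  map_injective h := QSup.hom_ext fun x => SymCat.congr_map h x

theorem comparison_full : (Monad.comparison (psAdj Q)).Full := by
  refine ⟨fun {X Y} f => ?_⟩
  let φ : (symmetrize X.toQCat).obj ⟶ (symmetrize Y.toQCat).obj := f.f.hom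
  have hφ : ∀ μ, Y.symSup.map ((directImage φ).map μ) = φ.map (X.symSup.map μ) := by
    intro μ
    refine (comparison_obj_a_map Y _).symm.trans
      (Eq.trans ?_ (congrArg φ.map (comparison_obj_a_map X μ)))
    exact SymCat.congr_map f.h μ
  let g : X.toQCat ⟶ Y.toQCat := symYoneda X.toQCat ≫ directImage φ ≫ Y.symSup
  have hg : ∀ x, g.map x = φ.map x := fun x => by
    change Y.symSup.map ((directImage φ).map _) = _
    rw [hφ, X.symSup_symYoneda]
  have hadj : IsAdjoint g (symYoneda Y.toQCat ≫ inverseImage φ ≫ X.symSup) := by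
    constructor
    · intro x
      have h : (presheafCat _).le ((symYoneda X.toQCat).map x)
          ((inverseImage φ).map ((symYoneda Y.toQCat).map (g.map x))) :=
        (directImage_isAdjoint φ).le_iff.1 (Y.symSup_isAdjoint.le_iff.1 (Y.toQCat.le_refl _))
      have := X.symSup.mono h
      rwa [X.symSup_symYoneda] at this
    · intro y
      rw [hg]
      change Y.toQCat.le (φ.map (X.symSup.map _)) y
      rw [← hφ]
      exact Y.symSup_isAdjoint.le_iff.2 ((directImage_isAdjoint φ).2 _)
  refine ⟨⟨g, _, hadj⟩, Monad.Algebra.Hom.ext ?_⟩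
  apply ObjectProperty.hom_ext
  exact QCat.hom_ext hg

theorem le_eqToHom_comp {p p' q : Q} (e : p = p') {u : p ⟶ q} {v : p' ⟶ q} :
    u ≤ eqToHom e ≫ v ↔ eqToHom e.symm ≫ u ≤ v := by
  subst e
  simp

theorem comp_eqToHom_le {p q q' : Q} (e : q = q') {u : p ⟶ q} {v : p ⟶ q'} :
    u ≫ eqToHom e ≤ v ↔ u ≤ v ≫ eqToHom e.symm := by
  subst e
  simp

theorem QCat.hom_congr (X : QCat Q) {x x' y y' : X.carrier} (hx : x = x') (hy : y = y')
    (ex : X.type x' = X.type x) (ey : X.type y = X.type y') :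
    eqToHom ex ≫ X.hom x y ≫ eqToHom ey = X.hom x' y' := by
  subst hx hy
  simp

/-! ### The separated complete `Q`-category of an algebra -/

namespace PsAlgebra

variable (A : (psMonad Q).Algebra)

/-- The structure map `(PA)_s ⟶ A` of an algebra. -/
noncomputable def act : (symmetrize (presheafCat A.A.obj)).obj ⟶ A.A.obj := A.a.hom

theorem act_yoneda (x : A.A.obj.carrier) : (act A).map ((yoneda A.A.obj).map x) = x :=
  SymCat.congr_map A.unit x

theorem act_freeSup (Φ : (presheafCat (symmetrize (presheafCat A.A.obj)).obj).carrier) :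
    (act A).map ((freeSup A.A.obj).map Φ) = (act A).map ((directImage (act A)).map Φ) := by
  rw [← psMonad_μ_app_map]
  exact SymCat.congr_map A.assoc Φ

theorem directImage_act_inverseImage (ν : (presheafCat A.A.obj).carrier) :
    (directImage (act A)).map ((inverseImage (act A)).map ν) = ν :=
  directImage_inverseImage (s := toSymmetrize A.A.property (yoneda A.A.obj))
    (QCat.hom_ext (act_yoneda A)) ν

/-- The largest presheaf with a given value under the structure map. -/
noncomputable def fibreTop : A.A.obj ⟶ presheafCat A.A.obj :=
  yoneda A.A.obj ≫ inverseImage (act A) ≫ freeSup A.A.obj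

theorem act_fibreTop (y : A.A.obj.carrier) : (act A).map ((fibreTop A).map y) = y := by
  change (act A).map ((freeSup A.A.obj).map ((inverseImage (act A)).map _)) = y
  rw [act_freeSup, directImage_act_inverseImage, act_yoneda]

theorem le_fibreTop (μ : (presheafCat A.A.obj).carrier) :
    (presheafCat A.A.obj).le μ ((fibreTop A).map ((act A).map μ)) := by
  have h : (presheafCat _).le ((yoneda (symmetrize (presheafCat A.A.obj)).obj).map μ)
      ((inverseImage (act A)).map ((yoneda A.A.obj).map ((act A).map μ))) := by
    refine (directImage_isAdjoint _).le_iff.1 ?_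
    rw [directImage_yoneda]
    exact QCat.le_refl _ _
  have h' := (freeSup A.A.obj).mono h
  rwa [freeSup_yoneda] at h'

theorem le_fibreTop_of_act_eq {μ : (presheafCat A.A.obj).carrier} {y : A.A.obj.carrier}
    (h : (act A).map μ = y) : (presheafCat A.A.obj).le μ ((fibreTop A).map y) := by
  rw [← h]
  exact le_fibreTop A μ

theorem symYoneda_fibreTop (y : A.A.obj.carrier) :
    (symYoneda (presheafCat A.A.obj)).map ((fibreTop A).map y) =
      (inverseImage (act A)).map ((fibreTop A).map y) := by
  refine presheafCat_isSeparated _ _ _ ?_ ?_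
  · refine (directImage_isAdjoint _).le_iff.1 (le_fibreTop_of_act_eq A ?_)
    rw [← act_freeSup, freeSup_symYoneda, act_fibreTop]
  · refine (freeSup_isAdjoint _).le_iff.1 (le_fibreTop_of_act_eq A ?_)
    rw [act_freeSup, directImage_act_inverseImage, act_fibreTop]

theorem hom_fibreTop (μ : (presheafCat A.A.obj).carrier) (y : A.A.obj.carrier) :
    (presheafCat A.A.obj).hom μ ((fibreTop A).map y) =
      eqToHom ((act A).type_map μ).symm ≫ ((fibreTop A).map y).2.val ((act A).map μ) := by
  have h := symYoneda_val (presheafCat A.A.obj) ((fibreTop A).map y) μ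
  rw [← h]
  have key : ∀ {a b : (presheafCat (symmetrize (presheafCat A.A.obj)).obj).carrier} (e : a = b),
      ∀ h : a.1 = b.1, a.2.val μ ≫ eqToHom h = b.2.val μ := by
    rintro a _ rfl _
    simp
  exact (Category.comp_id _).symm.trans (key (symYoneda_fibreTop A y) rfl)

/-- The `Q`-category underlying an algebra, with `β(x,y)` the hom of `PA` between the largest
presheaves over `x` and `y`. -/
noncomputable abbrev toQCat : QCat Q where
  carrier := A.A.obj.carrier
  type := A.A.obj.type
  hom x y := (presheafCat A.A.obj).hom ((fibreTop A).map x) ((fibreTop A).map y)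
  id_le x := (presheafCat A.A.obj).id_le ((fibreTop A).map x)
  comp_le x y z := (presheafCat A.A.obj).comp_le ((fibreTop A).map x) ((fibreTop A).map y)
    ((fibreTop A).map z)

theorem toQCat_hom (x y : A.A.obj.carrier) :
    (toQCat A).hom x y = ((fibreTop A).map y).2.val x :=
  (hom_fibreTop A _ y).trans (presheaf_val_congr _ (act_fibreTop A x) _)

theorem hom_fibreTop_eq (μ : (presheafCat A.A.obj).carrier) (y : A.A.obj.carrier) :
    (presheafCat A.A.obj).hom μ ((fibreTop A).map y) =
      eqToHom ((act A).type_map μ).symm ≫ (toQCat A).hom ((act A).map μ) y :=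
  (hom_fibreTop A μ y).trans (congrArg (_ ≫ ·) (toQCat_hom A _ y).symm)

theorem toQCat_le {x y : A.A.obj.carrier} :
    (toQCat A).le x y ↔ (presheafCat A.A.obj).le ((fibreTop A).map x) ((fibreTop A).map y) :=
  Iff.rfl

theorem act_le_iff {μ : (presheafCat A.A.obj).carrier} {y : A.A.obj.carrier} :
    (toQCat A).le ((act A).map μ) y ↔ (presheafCat A.A.obj).le μ ((fibreTop A).map y) := by
  constructor
  · exact fun h => (presheafCat A.A.obj).le_trans (le_fibreTop A μ) ((toQCat_le A).1 h)
  · rintro ⟨e, h⟩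
    exact ⟨((act A).type_map μ).trans e, (eqToHom_trans _ _).symm.le.trans
      ((le_eqToHom_comp _).1 (h.trans (hom_fibreTop_eq A μ y).le))⟩

theorem toQCat_isSeparated : (toQCat A).IsSeparated := fun x y h k => by
  have := presheafCat_isSeparated _ _ _ ((toQCat_le A).1 h) ((toQCat_le A).1 k)
  rw [← act_fibreTop A x, this, act_fibreTop]

theorem hom_le_toQCat_hom (x y : A.A.obj.carrier) : A.A.obj.hom x y ≤ (toQCat A).hom x y := by
  exact ((fibreTop A).hom_le x y).trans
    ((Category.id_comp _).trans (Category.comp_id _)).le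

theorem symmetrize_toQCat_hom (x y : A.A.obj.carrier) :
    A.A.obj.hom x y = (toQCat A).hom x y ⊓ InvolutiveQuantaloid.dag ((toQCat A).hom y x) := by
  refine le_antisymm (le_inf (hom_le_toQCat_hom A x y) ?_) ?_
  · rw [A.A.property]
    exact dag_mono (hom_le_toQCat_hom A y x)
  · exact ((act A).hom_le ((fibreTop A).map x) ((fibreTop A).map y)).trans
      (QCat.hom_congr _ (act_fibreTop A x) (act_fibreTop A y) _ _).le

/-- The identity map `A ⟶ toQCat A`. -/
def toToQCat : A.A.obj ⟶ toQCat A where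
  map x := x
  type_map _ := rfl
  hom_le x y := (hom_le_toQCat_hom A x y).trans
    ((Category.id_comp _).trans (Category.comp_id _)).symm.le

/-- The structure map as a `Q`-functor `PA ⟶ toQCat A`. -/
noncomputable def actQCat : presheafCat A.A.obj ⟶ toQCat A where
  map := (act A).map
  type_map := (act A).type_map
  hom_le μ ν := by
    obtain ⟨e, h⟩ := le_fibreTop A ν
    have h₁ : (presheafCat A.A.obj).hom μ ν ≫ eqToHom e ≤
        eqToHom ((act A).type_map μ).symm ≫ (toQCat A).hom ((act A).map μ) ((act A).map ν) :=
      ((comp_mono le_rfl h).trans ((presheafCat A.A.obj).comp_le _ _ _)).trans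
        (hom_fibreTop_eq A μ _).le
    exact ((comp_eqToHom_le e).1 h₁).trans (Category.assoc _ _ _).le

theorem inverseImage_toToQCat_yoneda (y : A.A.obj.carrier) :
    (inverseImage (toToQCat A)).map ((yoneda (toQCat A)).map y) = (fibreTop A).map y :=
  congrArg (Sigma.mk _) (Presheaf.ext (funext fun x =>
    (Category.id_comp _).trans (toQCat_hom A x y)))

theorem toQCat_isComplete : (toQCat A).IsComplete := by
  refine ⟨inverseImage (toToQCat A) ≫ actQCat A, ?_, ?_⟩
  · intro μ
    obtain ⟨e, h⟩ := presheafCat_le.1 (le_fibreTop A ((inverseImage (toToQCat A)).map μ))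
    refine presheafCat_le.2 ⟨e, fun x => ?_⟩
    refine le_trans ?_ ((h x).trans (toQCat_hom A _ _).symm.le)
    exact comp_mono (Category.id_comp _).symm.le le_rfl
  · intro y
    change (toQCat A).le ((act A).map ((inverseImage (toToQCat A)).map _)) y
    rw [inverseImage_toToQCat_yoneda, act_fibreTop]
    exact QCat.le_refl _ _

/-- The separated complete `Q`-category underlying an algebra. -/
noncomputable def toQSup : QSup Q := ⟨toQCat A, toQCat_isSeparated A, toQCat_isComplete A⟩

end PsAlgebra

theorem algebra_eq_of_a_eq {C : Type*} [Category* C] {T : Monad C} {A : C}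
    {a a' : T.obj A ⟶ A} (h : a = a') (unit unit' assoc assoc') :
    (⟨A, a, unit, assoc⟩ : T.Algebra) = ⟨A, a', unit', assoc'⟩ := by
  subst h
  rfl

/-- An algebra whose hom is the symmetrization of `β` and whose structure map computes suprema with
respect to `β` is the one that the comparison functor assigns to `β`. -/
theorem comparison_obj_eq (A : (psMonad Q).Algebra)
    (β : ∀ x y : A.A.obj.carrier, A.A.obj.type x ⟶ A.A.obj.type y) (id_le' comp_le')
    (hsep : QCat.IsSeparated ⟨A.A.obj.carrier, A.A.obj.type, β, id_le', comp_le'⟩)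
    (hcomp : QCat.IsComplete ⟨A.A.obj.carrier, A.A.obj.type, β, id_le', comp_le'⟩)
    (hβ : ∀ x y, A.A.obj.hom x y = β x y ⊓ InvolutiveQuantaloid.dag (β y x))
    (hle : ∀ (μ : (presheafCat A.A.obj).carrier) (y : A.A.obj.carrier),
      QCat.le ⟨A.A.obj.carrier, A.A.obj.type, β, id_le', comp_le'⟩
          ((PsAlgebra.act A).map μ) y ↔
        ∃ h : μ.1 = A.A.obj.type y, ∀ x, μ.2.val x ≫ eqToHom h ≤ β x y) :
    (Monad.comparison (psAdj Q)).obj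
      ⟨⟨A.A.obj.carrier, A.A.obj.type, β, id_le', comp_le'⟩, hsep, hcomp⟩ = A := by
  obtain ⟨⟨⟨X, type, hom, id_le, comp_le⟩, hsymm⟩, a, unit, assoc⟩ := A
  dsimp only at β id_le' comp_le' hsep hcomp hβ hle
  have hβ' : hom = fun x y => β x y ⊓ InvolutiveQuantaloid.dag (β y x) :=
    funext fun x => funext fun y => hβ x y
  subst hβ'
  refine algebra_eq_of_a_eq ?_ _ _ _ _
  refine ObjectProperty.hom_ext _ (QCat.hom_ext fun μ => ?_)
  refine (comparison_obj_a_map ⟨⟨X, type, β, id_le', comp_le'⟩, hsep, hcomp⟩ μ).trans ?_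
  refine hsep.eq_of_le_iff fun y => ?_
  refine (QSup.symSup_isAdjoint ⟨⟨X, type, β, id_le', comp_le'⟩, hsep, hcomp⟩).le_iff.trans
    (Iff.trans ?_ (hle μ y).symm)
  refine presheafCat_le.trans (exists_congr fun _ => forall_congr' fun x => ?_)
  exact iff_of_eq (congrArg (_ ≤ ·) (symYoneda_val _ y x))

theorem comparison_obj_toQSup (A : (psMonad Q).Algebra) :
    (Monad.comparison (psAdj Q)).obj (PsAlgebra.toQSup A) = A := by
  refine comparison_obj_eq A (PsAlgebra.toQCat A).hom _ _ (PsAlgebra.toQCat_isSeparated A)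
    (PsAlgebra.toQCat_isComplete A) (PsAlgebra.symmetrize_toQCat_hom A) fun μ y => ?_
  refine (PsAlgebra.act_le_iff A).trans ?_
  refine presheafCat_le.trans (exists_congr fun _ => forall_congr' fun x => ?_)
  exact iff_of_eq (congrArg (_ ≤ ·) (PsAlgebra.toQCat_hom A x y).symm)

theorem fibreTop_comparison (X : QSup Q) (y : X.toQCat.carrier) :
    (PsAlgebra.fibreTop ((Monad.comparison (psAdj Q)).obj X)).map y =
      (symYoneda X.toQCat).map y := by
  have hact : ∀ μ, (PsAlgebra.act ((Monad.comparison (psAdj Q)).obj X)).map μ = X.symSup.map μ :=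
    comparison_obj_a_map X
  refine presheafCat_isSeparated _ _ _ ?_ ?_
  · refine X.symSup_isAdjoint.le_iff.1 ?_
    have := (hact _).symm.trans (PsAlgebra.act_fibreTop ((Monad.comparison (psAdj Q)).obj X) y)
    rw [this]
    exact QCat.le_refl _ _
  · refine PsAlgebra.le_fibreTop_of_act_eq _ ?_
    exact (hact _).trans (X.symSup_symYoneda y)

theorem QSup.eq_of_hom_eq {X : Type u} {type : X → Q} {h h' : ∀ x y, type x ⟶ type y}
    (e : h = h') (id_le id_le' comp_le comp_le' sep sep' comp comp') :
    (⟨⟨X, type, h, id_le, comp_le⟩, sep, comp⟩ : QSup Q) =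
      ⟨⟨X, type, h', id_le', comp_le'⟩, sep', comp'⟩ := by
  subst e
  rfl

theorem toQSup_comparison (X : QSup Q) :
    PsAlgebra.toQSup ((Monad.comparison (psAdj Q)).obj X) = X := by
  refine QSup.eq_of_hom_eq (funext fun x => funext fun y => ?_) _ _ _ _ _ _ _ _
  refine ((Category.id_comp _).trans (Category.comp_id _)).symm.trans
    ((QCat.hom_congr _ (fibreTop_comparison X x) (fibreTop_comparison X y) rfl rfl).trans
      (symYoneda_hom X.toQCat x y))

instance comparison_isIso : (Monad.comparison (psAdj Q)).IsIso where
  full := comparison_full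
  bijective_obj := Function.bijective_iff_has_inverse.2
    ⟨PsAlgebra.toQSup, toQSup_comparison, comparison_obj_toQSup⟩

theorem isStrictlyMonadic_Us : IsStrictlyMonadic (Us Q) :=
  ⟨(psAdj Q).isRightAdjoint, fun _ adj => comparison_isIso_of_adj (psAdj Q) adj⟩

end Monadicity

/-! ### The multiplication of the monad -/

theorem freeSup_val {Q : Type u} [InvolutiveQuantaloid Q] (X : QCat Q)
    (Φ : (presheafCat (symmetrize (presheafCat X)).obj).carrier) (x : X.carrier) :
    ((freeSup X).map Φ).2.val x =
      ⨆ μ : (presheafCat X).carrier, μ.2.val x ≫ Φ.2.val μ := by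
  change (⨆ μ : (presheafCat X).carrier, μ.2.val x ≫ ⨆ ν : (presheafCat X).carrier,
    (presheafCat X).hom μ ν ≫ 𝟙 _ ≫ Φ.2.val ν) = _
  refine le_antisymm (iSup_le fun μ => ?_) (iSup_mono fun μ => comp_mono le_rfl ?_)
  · rw [comp_iSup]
    refine iSup_mono fun ν => ?_
    rw [Category.id_comp, ← Category.assoc]
    exact comp_mono (presheafCat_comp_hom μ ν x) le_rfl
  · refine le_iSup_of_le μ ?_
    have h := comp_mono ((presheafCat X).id_le μ) (le_refl (Φ.2.val μ))
    rw [Category.id_comp] at h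
    rw [Category.id_comp]
    exact h

/-! ### `V`-sets -/

section QSet

variable {V : Type u} [Monoid V] [CompleteLattice V] [StarMul V] [IsInvolutiveQuantale V]

theorem QSet.sim_self (X : QSet V) (x : X.obj.carrier) : X.sim x x = (X.obj.type x).val :=
  le_antisymm ((X.obj.hom x x).le_inf.trans inf_le_left) (X.obj.id_le x)

namespace DStar

theorem val_comp {p q r : DStar V} (d : p ⟶ q) (e : q ⟶ r) :
    Hom.val (d ≫ e) = (q.val ⇨ₗ Hom.val e) * Hom.val d := rfl

theorem val_hom_iSup {p q : DStar V} {ι : Sort*} (f : ι → (p ⟶ q)) :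
    Hom.val (⨆ i, f i) = ⨆ i, Hom.val (f i) := val_iSup f

theorem val_eqToHom_comp {p p' q : DStar V} (h : p = p') (d : p' ⟶ q) :
    Hom.val (eqToHom h ≫ d) = Hom.val d := by
  subst h
  simp

end DStar

theorem isPotentialSubset_of_presheaf (X : QSet V) {q : DStar V} (μ : Presheaf X.obj q) :
    IsPotentialSubset X (fun x => DStar.Hom.val (μ.val x)) q.val where
  herm := q.herm
  le_inf x := by rw [X.sim_self]; exact (μ.val x).le_inf
  left_div x := by rw [X.sim_self]; exact (μ.val x).left_div
  right_div x := (μ.val x).right_div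
  dist_eq x y := by rw [X.sim_self]; exact DStar.comp_eq (X.obj.hom x y) (μ.val y)
  dist_le x y := by rw [X.sim_self]; exact μ.dist y x

/-- The presheaf given by a potential `V`-subset. -/
def IsPotentialSubset.toPresheaf {X : QSet V} {m : X.obj.carrier → V} {q : V}
    (h : IsPotentialSubset X m q) : Presheaf X.obj (⟨q, h.herm⟩ : DStar V) where
  val x :=
    { val := m x
      le_inf := by rw [← X.sim_self]; exact h.le_inf x
      left_div := by rw [← X.sim_self]; exact h.left_div x
      right_div := h.right_div x }
  dist x x' := by
    have := h.dist_le x' x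
    rw [X.sim_self] at this
    exact this

theorem isPotentialSubset_iff (X : QSet V) (m : X.obj.carrier → V) (q : V) :
    IsPotentialSubset X m q ↔ ∃! μ : (presheafCat X.obj).carrier,
      μ.1.val = q ∧ ∀ x, DStar.Hom.val (μ.2.val x) = m x := by
  constructor
  · intro h
    refine ⟨⟨⟨q, h.herm⟩, h.toPresheaf⟩, ⟨rfl, fun _ => rfl⟩, ?_⟩
    rintro ⟨⟨q', hq'⟩, μ⟩ ⟨rfl, hμ⟩
    exact congrArg (Sigma.mk _) (Presheaf.ext (funext fun x => DStar.Hom.ext (hμ x)))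
  · rintro ⟨μ, ⟨rfl, hμ⟩, -⟩
    obtain rfl : _ = m := funext hμ
    exact isPotentialSubset_of_presheaf X μ.2

theorem directImage_val (X Y : QSet V) (f : X ⟶ Y) (μ : (presheafCat X.obj).carrier)
    (y : Y.obj.carrier) :
    DStar.Hom.val (((directImage f.hom).map μ).2.val y) =
      ⨆ x, (X.sim x x ⇨ₗ DStar.Hom.val (μ.2.val x)) * Y.sim y (f.hom.map x) := by
  refine (DStar.val_hom_iSup _).trans (iSup_congr fun x => ?_)
  rw [DStar.val_comp, DStar.val_eqToHom_comp, X.sim_self,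
    ← congrArg DStar.val (f.hom.type_map x)]

end QSet

end QEnriched

theorem theorem3p10 :
    (∀ (Q : Type u) [InvolutiveQuantaloid Q],
      -- `U_s` is strictly monadic, and `P_s ⊣ U_s` exhibits this: the comparison functor is an
      -- isomorphism from `Q`-**Sup** onto the Eilenberg–Moore category of the monad `P_s`
      IsStrictlyMonadic (Us Q) ∧
      (Monad.comparison (psAdj Q)).IsIso ∧
      Nonempty (IsoCat (psMonad Q).Algebra (QSup Q)) ∧
      -- the monad `P_s`: objects, maps, unit and multiplication
      (∀ X : SymCat Q, (psMonad Q).obj X = symmetrize (presheafCat X.obj)) ∧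
      (∀ (X Y : SymCat Q) (f : X ⟶ Y) (μ : (presheafCat X.obj).carrier),
        ((psMonad Q).map f).hom.map μ = (directImage f.hom).map μ) ∧
      (∀ (X : SymCat Q) (x : X.obj.carrier),
        ((psMonad Q).η.app X).hom.map x = (yoneda X.obj).map x) ∧
      (∀ (X : SymCat Q) (Φ : (presheafCat (symmetrize (presheafCat X.obj)).obj).carrier)
        (Ψ : (presheafCat X.obj).carrier), Ψ = ((psMonad Q).μ.app X).hom.map Φ →
        ∃ h : Ψ.1 = Φ.1, ∀ x, Ψ.2.val x ≫ eqToHom h =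
          ⨆ μ : (presheafCat X.obj).carrier, μ.2.val x ≫ Φ.2.val μ)) ∧
    (∀ (V : Type u) [Monoid V] [CompleteLattice V] [StarMul V] [IsInvolutiveQuantale V],
      -- the case `Q = D_*(V)`
      IsStrictlyMonadic (Us (DStar V) : QSup (DStar V) ⥤ QSet V) ∧
      Nonempty (IsoCat (powersetMonad V).Algebra (QSup (DStar V))) ∧
      -- elements of the powerset are the potential subsets
      (∀ (X : QSet V) (m : X.obj.carrier → V) (q : V), IsPotentialSubset X m q ↔
        ∃! μ : ((powersetMonad V).obj X).obj.carrier,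
          (((powersetMonad V).obj X).obj.type μ).val = q ∧
          ∀ x, DStar.Hom.val (Presheaf.val (Sigma.snd μ) x) = m x) ∧
      -- direct images
      (∀ (X Y : QSet V) (f : X ⟶ Y) (μ : (presheafCat X.obj).carrier)
        (ν : (presheafCat Y.obj).carrier), ν = ((powersetMonad V).map f).hom.map μ →
        ν.1 = μ.1 ∧ ∀ y, DStar.Hom.val (ν.2.val y) =
          ⨆ x, (X.sim x x ⇨ₗ DStar.Hom.val (μ.2.val x)) * Y.sim y (f.hom.map x)) ∧
      -- unit
      (∀ (X : QSet V) (x : X.obj.carrier) (ν : (presheafCat X.obj).carrier),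
        ν = ((powersetMonad V).η.app X).hom.map x →
        ν.1.val = X.sim x x ∧ ∀ y, DStar.Hom.val (ν.2.val y) = X.sim y x) ∧
      -- multiplication
      (∀ (X : QSet V) (Φ : (presheafCat (symmetrize (presheafCat X.obj)).obj).carrier)
        (ν : (presheafCat X.obj).carrier), ν = ((powersetMonad V).μ.app X).hom.map Φ →
        ν.1 = Φ.1 ∧ ∀ x, DStar.Hom.val (ν.2.val x) =
          ⨆ μ : (presheafCat X.obj).carrier,
            (μ.1.val ⇨ₗ DStar.Hom.val (Φ.2.val μ)) * DStar.Hom.val (μ.2.val x))) := by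
  refine ⟨fun Q _ => ⟨isStrictlyMonadic_Us, comparison_isIso,
    ⟨(Monad.comparison (psAdj Q)).asIsomorphism.symm⟩, fun _ => rfl, fun _ _ _ _ => rfl,
    psMonad_η_app_map, ?_⟩, fun V _ _ _ _ => ⟨isStrictlyMonadic_Us,
    ⟨(Monad.comparison (psAdj (DStar V))).asIsomorphism.symm⟩, isPotentialSubset_iff,
    ?_, ?_, ?_⟩⟩
  · rintro X Φ _ rfl
    rw [psMonad_μ_app_map]
    exact ⟨rfl, fun x => (Category.comp_id _).trans (freeSup_val X.obj Φ x)⟩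
  · rintro X Y f μ _ rfl
    exact ⟨rfl, directImage_val X Y f μ⟩
  · rintro X x _ rfl
    exact ⟨(X.sim_self x).symm, fun _ => rfl⟩
  · rintro X Φ _ rfl
    rw [psMonad_μ_app_map]
    exact ⟨rfl, fun x => (congrArg DStar.Hom.val (freeSup_val X.obj Φ x)).trans
      (DStar.val_hom_iSup _)⟩
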